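/- Consider the following game with action set $V=\{1,\dots,K\}$ and $T$ rounds. The environment fixes in advance loss functions $\ell_1,\dots,\ell_T\colon V\to[0,1]$ and undirected graphs $G_1,\dots,G_T$ on $V$, in which self-loops are allowed. Write $N_G(i)$ for the set of neighbours of $i$ in $G$ (it contains $i$ if and only if $i$ has a self-loop). In round $t$ the learner draws an action $I_t\in V$ from a distribution that may depend on everything it observed in rounds $1,\dots,t-1$ (including its own past actions), incurs the loss $\ell_t(I_t)$, and then observes the graph $G_t$ and the pairs $(i,\ell_t(i))$ for all $i\in N_{G_t}(I_t)$. A (randomized) algorithm is a rule that assigns to every $t$ and every past observation record a distribution on $V$ for the next action. Its regret is $$R_T=\mathbb E\Bigl[\sum_{t=1}^T \ell_t(I_t)\Bigr]-\min_{i\in V}\sum_{t=1}^T \ell_t(i),$$ where the expectation is over the learner's randomization. A graph $G$ is strongly observable if for every $i\in V$, $i\in N_G(i)$ or $i\in N_G(j)$ for all $j\ne i$; its independence number $\alpha(G)$ is the largest size of a set of vertices in which no two distinct vertices are neighbours. **Theorem.** Let $K\ge 2$ and $\alpha$ be integers with $2\le\alpha\le K$. Then for every algorithm and every integer $T\ge\dfrac{\alpha\log_\alpha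 K}{4\ln(4/3)}$ there exist losses $\ell_1,\dots,\ell_T\colon V\to[0,1]$ and strongly observable undirected feedback graphs $G_1,\dots,G_T$ on $V$ with $\alpha(G_t)=\alpha$ for all $t=1,\dots,T$, such that $$R_T\;\ge\;\frac{1}{18\sqrt2}\sqrt{\alpha\,T\log_\alpha K}.$$ -/

import Mathlib

open scoped ENNReal

/-- An undirected graph on the action set `Fin K`, in which self-loops are allowed. -/
structure FeedbackGraph (K : ℕ) where
  Adj : Fin K → Fin K → Prop
  symm : ∀ i j, Adj i j → Adj j i

namespace FeedbackGraph

variable {K : ℕ}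

/-- The neighbourhood of `i`; it contains `i` itself exactly when `i` has a self-loop. -/
def neighbors (G : FeedbackGraph K) (i : Fin K) : Set (Fin K) := {j | G.Adj i j}

/-- Every action has a self-loop or is a neighbour of all the other actions. -/
def StronglyObservable (G : FeedbackGraph K) : Prop :=
  ∀ i, i ∈ G.neighbors i ∨ ∀ j, j ≠ i → i ∈ G.neighbors j

/-- The underlying simple graph, obtained by deleting the self-loops. -/
def toSimpleGraph (G : FeedbackGraph K) : SimpleGraph (Fin K) where
  Adj i j := i ≠ j ∧ G.Adj i j
  symm := ⟨fun i j h => ⟨h.1.symm, G.symm i j h.2⟩⟩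
  loopless := ⟨fun _ h => h.1 rfl⟩

/-- The independence number: the largest size of a set of actions in which no two (distinct)
actions are neighbours. -/
noncomputable def indepNum (G : FeedbackGraph K) : ℕ := G.toSimpleGraph.indepNum

end FeedbackGraph

/-- What the learner knows about one completed round: the action that it played, the feedback
graph, and the revealed pairs (action, loss of that action). -/
structure RoundRecord (K : ℕ) where
  action : Fin K
  graph : FeedbackGraph K
  observed : Set (Fin K × ℝ)

/-- A (randomized) algorithm for the learner: for every number `t` of completed rounds and every
possible record of these rounds, a distribution over actions, from which the next action is
drawn. -/
def LearnerAlgorithm (K : ℕ) : Type := (t : ℕ) → (Fin t → RoundRecord K) → PMF (Fin K)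

/-- The record of a round in which the loss function is `l`, the graph is `G`, and `i` is played:
the losses of the neighbours of `i` are revealed. -/
def playRound {K : ℕ} (l : Fin K → ℝ) (G : FeedbackGraph K) (i : Fin K) : RoundRecord K where
  action := i
  graph := G
  observed := {x | ∃ j ∈ G.neighbors i, x = (j, l j)}

/-- The record of the rounds before round `t`, if the learner plays the actions `a`. -/
def pastRecord {K T : ℕ} (l : Fin T → Fin K → ℝ) (G : Fin T → FeedbackGraph K)
    (a : Fin T → Fin K) (t : Fin T) : Fin t → RoundRecord K :=
  fun s => playRound (l (s.castLE t.isLt.le)) (G (s.castLE t.isLt.le)) (a (s.castLE t.isLt.le))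

theorem sum_prod_conditional_eq_one {V : Type} [Fintype V] (T : ℕ)
    (w : (t : Fin T) → (Fin t → V) → PMF V) :
    ∑ a : Fin T → V, ∏ t : Fin T, w t (fun s => a (s.castLE t.isLt.le)) (a t) = 1 := by
  induction T with
  | zero => simp
  | succ T ih =>
    rw [← (Fin.snocEquiv (fun _ : Fin (T + 1) => V)).sum_comp, Fintype.sum_prod_type_right]
    rw [← ih (fun t p => w t.castSucc p)]
    refine Finset.sum_congr rfl fun a _ => ?_
    have key : ∀ v : V,
        ∏ t : Fin (T + 1), w t
          (fun s => (Fin.snocEquiv (fun _ : Fin (T + 1) => V)) (v, a) (s.castLE t.isLt.le))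
          ((Fin.snocEquiv (fun _ : Fin (T + 1) => V)) (v, a) t)
        = (∏ t : Fin T, w t.castSucc (fun s => a (s.castLE t.isLt.le)) (a t)) *
            w (Fin.last T) a v := by
      intro v
      rw [Fin.prod_univ_castSucc]
      have h : ∀ (n : ℕ) (hn : n ≤ T) (s : Fin n),
          (Fin.snocEquiv (fun _ : Fin (T + 1) => V)) (v, a) (s.castLE (Nat.le_succ_of_le hn))
            = a (s.castLE hn) := by
        intro n hn s
        exact Fin.snoc_castSucc (α := fun _ => V) v a (s.castLE hn)
      congr 1
      · refine Finset.prod_congr rfl fun t _ => ?_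
        congr 2
        · funext s
          exact h t t.isLt.le s
        · exact Fin.snoc_castSucc (α := fun _ => V) v a t
      · congr 2
        · funext s
          exact h T le_rfl s
        · exact Fin.snoc_last (α := fun _ => V) v a
    rw [Finset.sum_congr rfl fun v _ => key v, ← Finset.mul_sum]
    have h1 : ∑ v : V, w (Fin.last T) a v = 1 :=
      (tsum_fintype _).symm.trans (w (Fin.last T) a).tsum_coe
    rw [h1, mul_one]
    rfl

/-- The law of the sequence of actions that an algorithm plays against given losses and graphs:
in round `t` the action is drawn from the distribution that the algorithm chooses on the basis
of the record of the earlier rounds. -/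
noncomputable def actionLaw {K T : ℕ} (alg : LearnerAlgorithm K) (l : Fin T → Fin K → ℝ)
    (G : Fin T → FeedbackGraph K) : PMF (Fin T → Fin K) :=
  PMF.ofFintype (fun a => ∏ t : Fin T, alg t (pastRecord l G a t) (a t))
    (sum_prod_conditional_eq_one T fun t p => alg t fun s =>
      playRound (l (s.castLE t.isLt.le)) (G (s.castLE t.isLt.le)) (p s))

/-- The regret: the expected cumulative loss of the algorithm minus the cumulative loss of the
best fixed action. -/
noncomputable def regret {K T : ℕ} (alg : LearnerAlgorithm K) (l : Fin T → Fin K → ℝ)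
    (G : Fin T → FeedbackGraph K) : ℝ :=
  (∑ a : Fin T → Fin K, (actionLaw alg l G a).toReal * ∑ t, l t (a t)) - ⨅ i : Fin K, ∑ t, l t i

/-! With `M = Nat.log α K`, the actions are mapped onto the words `Fin M → Fin α`, and the rounds
are dealt cyclically to `M` games. In a round of game `m`, actions sharing their `m`-th letter form
a clique and have equal losses. A play thus reveals a single bit, and each game is an `α`-armed
bandit with about `T / M` rounds. Since every word labels some action, any choice of good arms has
an action that is good in all games. The regrets of the games therefore add up, to order `M * √(α *
T / M) = √(α * T * M)`.

In each game the good arm is uniform and its loss is biased by `ε` towards `0`. The comparison law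
has no good arm in that game. By the change of measure `sum_mul_exp_neg_sub_le`, making `e` good
raises the expected fraction of rounds spent on `e` by at most the relative entropy plus `1 / 8`.
That entropy is proportional to the pulls of `e` under the comparison law, and these sum over `e` to
the length of the game (`sum_gameWeight_update_le`, `sum_sum_gameWeight_pullCount_le`). Hence the
good arm is missed in a constant fraction of the rounds. `exists_bits_le_regret` passes from random
to fixed losses, and `sqrt_le_of_tuned` settles the constant. -/

/-! ### Path measures generated by sequential kernels -/

/-- The weight of a path when each coordinate is weighted by a kernel given the earlier ones. -/
def pathWeight {V : Type} {T : ℕ} (w : (t : Fin T) → (Fin t → V) → V → ℝ) (a : Fin T → V) : ℝ :=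
  ∏ t : Fin T, w t (fun s => a (s.castLE t.isLt.le)) (a t)

theorem pathWeight_snoc {V : Type} {T : ℕ} (w : (t : Fin (T + 1)) → (Fin t → V) → V → ℝ)
    (a : Fin T → V) (v : V) :
    pathWeight w (Fin.snoc (α := fun _ => V) a v) =
      pathWeight (fun t p => w t.castSucc p) a * w (Fin.last T) a v := by
  have h : ∀ (n : ℕ) (hn : n ≤ T) (s : Fin n),
      Fin.snoc (α := fun _ => V) a v (s.castLE (Nat.le_succ_of_le hn)) = a (s.castLE hn) :=
    fun n hn s => Fin.snoc_castSucc (α := fun _ => V) v a (s.castLE hn)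
  unfold pathWeight
  rw [Fin.prod_univ_castSucc]
  congr 1
  · refine Finset.prod_congr rfl fun t _ => ?_
    congr 1
    · funext s
      exact h t t.isLt.le s
    · exact Fin.snoc_castSucc (α := fun _ => V) v a t
  · congr 1
    · funext s
      exact h T le_rfl s
    · exact Fin.snoc_last (α := fun _ => V) v a

theorem sum_pathWeight_succ {V : Type} [Fintype V] {T : ℕ}
    (w : (t : Fin (T + 1)) → (Fin t → V) → V → ℝ) (F : (Fin (T + 1) → V) → ℝ) :
    ∑ a, pathWeight w a * F a =
      ∑ a : Fin T → V, pathWeight (fun t p => w t.castSucc p) a *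
        ∑ v, w (Fin.last T) a v * F (Fin.snoc (α := fun _ => V) a v) := by
  rw [← (Fin.snocEquiv (fun _ : Fin (T + 1) => V)).sum_comp, Fintype.sum_prod_type_right]
  refine Finset.sum_congr rfl fun a _ => ?_
  rw [Finset.mul_sum]
  refine Finset.sum_congr rfl fun v _ => ?_
  change pathWeight w (Fin.snoc (α := fun _ => V) a v) *
    F (Fin.snoc (α := fun _ => V) a v) = _
  rw [pathWeight_snoc, mul_assoc]

theorem sum_pathWeight {V : Type} [Fintype V] {T : ℕ}
    (w : (t : Fin T) → (Fin t → V) → V → ℝ) (hw : ∀ t p, ∑ v, w t p v = 1) :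
    ∑ a, pathWeight w a = 1 := by
  induction T with
  | zero => simp [pathWeight]
  | succ T ih =>
    have h := sum_pathWeight_succ w fun _ => 1
    simp only [mul_one] at h
    rw [h, ← ih (fun t p => w t.castSucc p) fun t p => hw t.castSucc p]
    exact Finset.sum_congr rfl fun a _ => by rw [hw (Fin.last T) a, mul_one]

/-- The tower property: a coordinate may be replaced by its conditional mean. -/
theorem sum_pathWeight_mul_eq {V : Type} [Fintype V] {T : ℕ}
    (w : (t : Fin T) → (Fin t → V) → V → ℝ) (hw : ∀ t p, ∑ v, w t p v = 1)
    (t : Fin T) (f : V → ℝ) :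
    ∑ a, pathWeight w a * f (a t) =
      ∑ a, pathWeight w a * ∑ v, w t (fun s => a (s.castLE t.isLt.le)) v * f v := by
  induction T with
  | zero => exact t.elim0
  | succ T ih =>
    rw [sum_pathWeight_succ, sum_pathWeight_succ]
    induction t using Fin.lastCases with
    | last =>
      refine Finset.sum_congr rfl fun a _ => ?_
      congr 1
      have e : ∀ v : V, (fun s : Fin (Fin.last T : Fin (T + 1)) =>
          Fin.snoc (α := fun _ => V) a v (s.castLE (Fin.last T).isLt.le)) = a := by
        intro v
        funext s
        exact Fin.snoc_castSucc (α := fun _ => V) v a s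
      have e2 : ∀ v : V, Fin.snoc (α := fun _ => V) a v (Fin.last T) = v :=
        fun v => Fin.snoc_last (α := fun _ => V) v a
      simp only [e, e2]
      rw [← Finset.sum_mul, hw (Fin.last T) a, one_mul]
    | cast t =>
      have e : ∀ (a : Fin T → V) (v : V), (fun s : Fin (t.castSucc : Fin (T + 1)) =>
          Fin.snoc (α := fun _ => V) a v (s.castLE t.castSucc.isLt.le)) =
            fun s => a (s.castLE t.isLt.le) := by
        intro a v
        funext s
        exact Fin.snoc_castSucc (α := fun _ => V) v a (s.castLE t.isLt.le)
      have e2 : ∀ (a : Fin T → V) (v : V),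
          Fin.snoc (α := fun _ => V) a v t.castSucc = a t :=
        fun a v => Fin.snoc_castSucc (α := fun _ => V) v a t
      simp only [e, e2, ← Finset.sum_mul]
      -- The last coordinate comes after `t`, so it integrates out.
      have hL : ∀ a : Fin T → V, ∑ v, w (Fin.last T) a v = 1 := fun a => hw (Fin.last T) a
      simp only [hL, one_mul]
      exact ih (fun t p => w t.castSucc p) (fun t p => hw t.castSucc p) t

/-! ### Product laws and their marginals -/

theorem sum_prod_apply {ι V : Type} [Fintype ι] [DecidableEq ι] [Fintype V] (h : ι → V → ℝ) :
    ∑ y : ι → V, ∏ t, h t (y t) = ∏ t, ∑ v, h t v := by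
  rw [Finset.prod_univ_sum, Fintype.piFinset_univ]

/-- Under a product law on `y`, the coordinates `y t (d t)` are independent with their marginals. -/
theorem sum_prod_prod_mul_comp {ι D : Type} [Fintype ι] [DecidableEq ι] [Fintype D]
    [DecidableEq D] (q : ι → D → Bool → ℝ) (hq : ∀ t d, ∑ b, q t d b = 1) (d : ι → D)
    (F : (ι → Bool) → ℝ) :
    ∑ y : ι → D → Bool, (∏ t, ∏ e, q t e (y t e)) * F (fun t => y t (d t)) =
      ∑ b : ι → Bool, (∏ t, q t (d t) (b t)) * F b := by
  have marg : ∀ b : ι → Bool,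
      ∑ y : ι → D → Bool, (∏ t, ∏ e, q t e (y t e)) * (if (fun t => y t (d t)) = b then 1 else 0)
        = ∏ t, q t (d t) (b t) := by
    intro b
    -- The indicator of the event factorizes over all pairs `(t, e)`, being trivial off `e = d t`,
    -- so the sum over `y` becomes a product.
    have h1 : ∀ y : ι → D → Bool,
        (∏ t, ∏ e, q t e (y t e)) * (if (fun t => y t (d t)) = b then (1 : ℝ) else 0) =
          ∏ t, ∏ e, q t e (y t e) * (if e = d t then (if y t e = b t then 1 else 0) else 1) := by
      intro y
      simp_rw [Finset.prod_mul_distrib]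
      congr 1
      simp only [Finset.prod_ite_eq', Finset.mem_univ, if_true]
      rw [Finset.prod_ite_zero]
      simp [funext_iff]
    simp_rw [h1]
    rw [sum_prod_apply fun t (z : D → Bool) => ∏ e, q t e (z e) *
      (if e = d t then (if z e = b t then (1 : ℝ) else 0) else 1)]
    refine Finset.prod_congr rfl fun t _ => ?_
    rw [sum_prod_apply fun e (v : Bool) => q t e v *
      (if e = d t then (if v = b t then (1 : ℝ) else 0) else 1)]
    rw [Finset.prod_eq_single (d t)]
    · simp
    · intro e _ he
      simp only [if_neg he, mul_one]
      exact hq t e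
    · simp
  calc _ = ∑ y : ι → D → Bool, ∑ b : ι → Bool, (∏ t, ∏ e, q t e (y t e)) *
          (if (fun t => y t (d t)) = b then 1 else 0) * F b := by
        refine Finset.sum_congr rfl fun y _ => ?_
        simp
    _ = _ := by
        rw [Finset.sum_comm]
        refine Finset.sum_congr rfl fun b _ => ?_
        rw [← Finset.sum_mul, marg]

/-! ### Change of measure and numerical bounds -/

/-- This is Hoeffding's lemma for a Bernoulli variable of mean `μ` at exponent `-1`. The left side
is affine in `μ` and lies below a near-tangent line of the convex right side. -/
theorem one_sub_mul_le_exp (μ : ℝ) (hμ : μ ≤ 1) :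
    1 - μ + μ * Real.exp (-1) ≤ Real.exp (1 / 8 - μ) := by
  have h1 := Real.exp_one_gt_d9
  have h2 := Real.exp_one_lt_d9
  set c := 1 - Real.exp (-1) with hc
  have he : Real.exp (-1) * Real.exp 1 = 1 := by rw [← Real.exp_add]; simp
  have hpos := Real.exp_pos (-1 : ℝ)
  have c1 : 0.63211 ≤ c := by nlinarith
  have c2 : c ≤ 0.63213 := by nlinarith
  -- The number `0.458` is just below `-log (1 - exp (-1))`, so the tangent at `μ = 0.583 = 1 / 8 +
  -- 0.458` has nearly the slope `-c`.
  have h0 : c * Real.exp 0.458 ≤ 1 := by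
    have : Real.exp 0.458 ≤ 1.5812 := by
      have := Real.exp_bound' (x := 0.458) (by norm_num) (by norm_num) (n := 6) (by norm_num)
      refine this.trans ?_
      norm_num [Finset.sum_range_succ, Nat.factorial]
    nlinarith [Real.exp_pos 0.458]
  have h3 : c ≤ Real.exp (-0.458) := by
    have : Real.exp (-0.458) * Real.exp 0.458 = 1 := by rw [← Real.exp_add]; simp
    nlinarith [Real.exp_pos 0.458]
  have h4 : Real.exp (1 / 8 - μ) = Real.exp (-0.458) * Real.exp (0.583 - μ) := by
    rw [← Real.exp_add]; norm_num; ring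
  have h5 := Real.add_one_le_exp (0.583 - μ)
  rw [h4]
  have h6 : c * (1.583 - μ) ≤ Real.exp (-0.458) * Real.exp (0.583 - μ) :=
    mul_le_mul h3 (by linarith) (by linarith) (Real.exp_pos _).le
  have h7 : Real.exp (-1) = 1 - c := by rw [hc]; ring
  rw [h7]
  nlinarith

/-- Change of measure: if `P * exp (-R)` is again a probability, then the mean of a function with
values in `[0, 1]` grows by at most the relative entropy plus `1 / 8`. -/
theorem sum_mul_exp_neg_sub_le {Ω : Type} [Fintype Ω] (P R f : Ω → ℝ) (hP : ∀ x, 0 ≤ P x)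
    (h1 : ∑ x, P x = 1) (hQ : ∑ x, P x * Real.exp (-R x) = 1)
    (hf : ∀ x, f x ∈ Set.Icc (0 : ℝ) 1) :
    ∑ x, P x * Real.exp (-R x) * f x - ∑ x, P x * f x ≤ ∑ x, P x * R x + 1 / 8 := by
  set μ := ∑ x, P x * Real.exp (-R x) * f x with hμ
  have hZ : ∑ x, P x * Real.exp (-R x) * Real.exp (-f x) ≤ Real.exp (1 / 8 - μ) := by
    have hμ1 : μ ≤ 1 := by
      rw [hμ, ← hQ]
      exact Finset.sum_le_sum fun x _ =>
        mul_le_of_le_one_right (mul_nonneg (hP x) (Real.exp_pos _).le) (hf x).2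
    refine le_trans ?_ (one_sub_mul_le_exp μ hμ1)
    -- The chord of the convex function `exp (-·)` over `[0, 1]` reduces `f` to its mean.
    have hx : ∀ x, Real.exp (-f x) ≤ 1 - f x + f x * Real.exp (-1) := by
      intro x
      have := convexOn_exp.2 (Set.mem_univ 0) (Set.mem_univ (-1))
        (sub_nonneg.2 (hf x).2) (hf x).1 (by ring)
      simpa using this
    calc _ ≤ ∑ x, P x * Real.exp (-R x) * (1 - f x + f x * Real.exp (-1)) :=
          Finset.sum_le_sum fun x _ =>
            mul_le_mul_of_nonneg_left (hx x) (mul_nonneg (hP x) (Real.exp_pos _).le)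
      _ = ∑ x, P x * Real.exp (-R x) - μ + μ * Real.exp (-1) := by
          rw [hμ, Finset.sum_mul, ← Finset.sum_sub_distrib, ← Finset.sum_add_distrib]
          exact Finset.sum_congr rfl fun x _ => by ring
      _ = _ := by rw [hQ]
  -- The bound `1 + u ≤ exp u`, applied pointwise, replaces the variational formula for relative
  -- entropy; the shift `1 / 8 - μ` normalizes the exponential moment.
  have hlow : ∑ x, P x * (1 - R x - f x - (1 / 8 - μ)) ≤
      Real.exp (-(1 / 8 - μ)) * ∑ x, P x * Real.exp (-R x) * Real.exp (-f x) := by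
    rw [Finset.mul_sum]
    refine Finset.sum_le_sum fun x _ => ?_
    have := Real.add_one_le_exp (-R x + -f x + -(1 / 8 - μ))
    rw [Real.exp_add, Real.exp_add] at this
    calc _ ≤ P x * (Real.exp (-R x) * Real.exp (-f x) * Real.exp (-(1 / 8 - μ))) :=
          mul_le_mul_of_nonneg_left (by linarith) (hP x)
      _ = _ := by ring
  have hup : Real.exp (-(1 / 8 - μ)) * ∑ x, P x * Real.exp (-R x) * Real.exp (-f x) ≤ 1 := by
    refine (mul_le_mul_of_nonneg_left hZ (Real.exp_pos _).le).trans ?_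
    rw [← Real.exp_add]; simp
  have hexp : ∑ x, P x * (1 - R x - f x - (1 / 8 - μ)) =
      1 - ∑ x, P x * R x - ∑ x, P x * f x - (1 / 8 - μ) := by
    have : ∀ x, P x * (1 - R x - f x - (1 / 8 - μ)) =
        P x - P x * R x - P x * f x - P x * (1 / 8 - μ) := fun x => by ring
    simp_rw [this, Finset.sum_sub_distrib, ← Finset.sum_mul, h1, one_mul]
  linarith

/-- The left side is the relative entropy of a fair bit with respect to a biased one. Concavity puts
`log` above its chord between `3 / 4` and `1`, with equality at `ε = 1 / 4`; this is the origin of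
`log (4 / 3)`. -/
theorem neg_log_one_sub_le (ε : ℝ) (h0 : 0 ≤ ε) (h1 : ε ≤ 1 / 4) :
    -(1 / 2) * Real.log (1 - 4 * ε ^ 2) ≤ 8 * Real.log (4 / 3) * ε ^ 2 := by
  have hx1 : 16 * ε ^ 2 ≤ 1 := by nlinarith
  have := strictConcaveOn_log_Ioi.concaveOn.2 (x := 1) (y := 3 / 4)
    (by simp) (by norm_num) (sub_nonneg.2 hx1) (by positivity : 0 ≤ 16 * ε ^ 2) (by ring)
  have h34 : Real.log (3 / 4) = -Real.log (4 / 3) := by rw [← Real.log_inv]; norm_num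
  simp only [smul_eq_mul, Real.log_one, mul_zero, zero_add, h34, mul_one] at this
  have e : 1 - 16 * ε ^ 2 + 16 * ε ^ 2 * (3 / 4) = 1 - 4 * ε ^ 2 := by ring
  rw [e] at this
  nlinarith

theorem log_four_thirds_le : Real.log (4 / 3) ≤ 0.288 := by
  rw [Real.log_le_iff_le_exp (by norm_num)]
  have := Real.sum_le_exp_of_nonneg (x := 0.288) (by norm_num) 5
  refine le_trans ?_ this
  norm_num [Finset.sum_range_succ, Nat.factorial]

/-- Resampling one coordinate of a uniform function leaves it uniform. -/
theorem sum_sum_update {ι A : Type} [Fintype ι] [DecidableEq ι] [Fintype A] (m : ι)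
    (f : (ι → A) → ℝ) :
    ∑ θ : ι → A, ∑ i, f (Function.update θ m i) = Fintype.card A * ∑ θ, f θ := by
  -- Swapping coordinate `m` with the fresh value is a bijection of the pairs.
  have hinv : Function.Involutive
      fun x : (ι → A) × A => (Function.update x.1 m x.2, x.1 m) := by
    rintro ⟨θ, i⟩
    simp
  rw [← Fintype.sum_prod_type' fun θ i => f (Function.update θ m i),
    ← Equiv.sum_comp hinv.toPerm, Fintype.sum_prod_type]
  simp [Function.Involutive.toPerm, Finset.mul_sum]

/-! ### Bandit games with one revealed bit per round -/

/-- The kernel that draws an action by `A` and then a bit whose law `q` depends on the action. -/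
def actionBitKernel {V : Type} {T : ℕ} (A : (t : Fin T) → (Fin t → V × Bool) → V → ℝ)
    (q : Fin T → V → Bool → ℝ) (t : Fin T) (p : Fin t → V × Bool) (v : V × Bool) : ℝ :=
  A t p v.1 * q t v.1 v.2

theorem sum_actionBitKernel {V : Type} [Fintype V] {T : ℕ}
    {A : (t : Fin T) → (Fin t → V × Bool) → V → ℝ} {q : Fin T → V → Bool → ℝ}
    (hA : ∀ t p, ∑ i, A t p i = 1) (hq : ∀ t i, ∑ b, q t i b = 1) (t : Fin T)
    (p : Fin t → V × Bool) : ∑ v, actionBitKernel A q t p v = 1 := by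
  rw [Fintype.sum_prod_type]
  simp only [actionBitKernel, ← Finset.mul_sum, hq, mul_one, hA]

theorem pathWeight_actionBitKernel_nonneg {V : Type} {T : ℕ}
    {A : (t : Fin T) → (Fin t → V × Bool) → V → ℝ} {q : Fin T → V → Bool → ℝ}
    (hA : ∀ t p i, 0 ≤ A t p i) (hq : ∀ t i b, 0 ≤ q t i b) (ω : Fin T → V × Bool) :
    0 ≤ pathWeight (actionBitKernel A q) ω :=
  Finset.prod_nonneg fun _ _ => mul_nonneg (hA _ _ _) (hq _ _ _)

/-- Given the action, the bit may be replaced by its mean. -/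
theorem sum_pathWeight_actionBitKernel_mul {V : Type} [Fintype V] {T : ℕ}
    {A : (t : Fin T) → (Fin t → V × Bool) → V → ℝ} {q : Fin T → V → Bool → ℝ}
    (hA : ∀ t p, ∑ i, A t p i = 1) (hq : ∀ t i, ∑ b, q t i b = 1) (t : Fin T)
    (g : V → Bool → ℝ) :
    ∑ ω, pathWeight (actionBitKernel A q) ω * g (ω t).1 (ω t).2 =
      ∑ ω, pathWeight (actionBitKernel A q) ω * ∑ b, q t (ω t).1 b * g (ω t).1 b := by
  have hw := sum_actionBitKernel hA hq
  rw [sum_pathWeight_mul_eq _ hw t fun v => g v.1 v.2,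
    sum_pathWeight_mul_eq _ hw t fun v => ∑ b, q t v.1 b * g v.1 b]
  refine Finset.sum_congr rfl fun ω _ => ?_
  congr 1
  rw [Fintype.sum_prod_type, Fintype.sum_prod_type]
  refine Finset.sum_congr rfl fun i _ => ?_
  simp only [actionBitKernel]
  rw [← Finset.sum_mul, ← Finset.mul_sum, hq, mul_one, Finset.mul_sum]
  exact Finset.sum_congr rfl fun b _ => by ring

/-- Both laws use the same policy `A`, so the action probabilities cancel in the likelihood ratio
and only the bits contribute. -/
theorem pathWeight_actionBitKernel_exp {V : Type} {T : ℕ}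
    (A : (t : Fin T) → (Fin t → V × Bool) → V → ℝ) {q q' r : Fin T → V → Bool → ℝ}
    (h : ∀ t i b, q' t i b = q t i b * Real.exp (-r t i b)) (ω : Fin T → V × Bool) :
    pathWeight (actionBitKernel A q') ω =
      pathWeight (actionBitKernel A q) ω * Real.exp (-∑ t, r t (ω t).1 (ω t).2) := by
  rw [← Finset.sum_neg_distrib, Real.exp_sum]
  unfold pathWeight
  rw [← Finset.prod_mul_distrib]
  refine Finset.prod_congr rfl fun t _ => ?_
  simp only [actionBitKernel]
  rw [h, mul_assoc]

/-- The law of a bit that is `true` with probability `1 / 2 - x`. -/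
noncomputable def biasedBit (x : ℝ) (b : Bool) : ℝ := if b then 1 / 2 - x else 1 / 2 + x

theorem sum_biasedBit (x : ℝ) : ∑ b, biasedBit x b = 1 := by
  simp [biasedBit]; ring

theorem biasedBit_pos {x : ℝ} (h0 : 0 ≤ x) (h1 : x ≤ 1 / 4) (b : Bool) : 0 < biasedBit x b := by
  cases b <;> simp [biasedBit] <;> linarith

/-- The bias of arm `e` in round `t`: the round belongs to the game `τ t`, in which the arm
`θ (τ t)`, if any, is the good one. -/
def armBias {T M α : ℕ} (ε : ℝ) (τ : Fin T → Fin M) (θ : Fin M → Option (Fin α)) (t : Fin T)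
    (e : Fin α) : ℝ := if θ (τ t) = some e then ε else 0

theorem armBias_mem {T M α : ℕ} {ε : ℝ} (h0 : 0 ≤ ε) (h1 : ε ≤ 1 / 4) (τ : Fin T → Fin M)
    (θ : Fin M → Option (Fin α)) (t : Fin T) (e : Fin α) :
    0 ≤ armBias ε τ θ t e ∧ armBias ε τ θ t e ≤ 1 / 4 := by
  unfold armBias
  split_ifs
  · exact ⟨h0, h1⟩
  · norm_num

/-- The number of rounds of the game `m` in which the arm `e` is played. -/
def pullCount {V : Type} {T M α : ℕ} (τ : Fin T → Fin M) (c : Fin T → V → Fin α) (m : Fin M)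
    (e : Fin α) (ω : Fin T → V × Bool) : ℝ := ∑ t, if τ t = m ∧ c t (ω t).1 = e then 1 else 0

/-- The number of rounds of the game `m`. -/
def gameLength {T M : ℕ} (τ : Fin T → Fin M) (m : Fin M) : ℝ := ∑ t, if τ t = m then 1 else 0

theorem gameLength_nonneg {T M : ℕ} (τ : Fin T → Fin M) (m : Fin M) : 0 ≤ gameLength τ m :=
  Finset.sum_nonneg fun t _ => by split_ifs <;> norm_num

theorem pullCount_nonneg {V : Type} {T M α : ℕ} (τ : Fin T → Fin M) (c : Fin T → V → Fin α)
    (m : Fin M) (e : Fin α) (ω : Fin T → V × Bool) : 0 ≤ pullCount τ c m e ω :=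
  Finset.sum_nonneg fun t _ => by split_ifs <;> norm_num

theorem pullCount_le {V : Type} {T M α : ℕ} (τ : Fin T → Fin M) (c : Fin T → V → Fin α)
    (m : Fin M) (e : Fin α) (ω : Fin T → V × Bool) : pullCount τ c m e ω ≤ gameLength τ m :=
  Finset.sum_le_sum fun t _ => by
    by_cases h : τ t = m <;> simp only [h, true_and, false_and, if_true, if_false]
    · split_ifs <;> norm_num
    · exact le_rfl

theorem sum_pullCount {V : Type} {T M α : ℕ} (τ : Fin T → Fin M) (c : Fin T → V → Fin α)
    (m : Fin M) (ω : Fin T → V × Bool) : ∑ e, pullCount τ c m e ω = gameLength τ m := by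
  unfold pullCount gameLength
  rw [Finset.sum_comm]
  refine Finset.sum_congr rfl fun t _ => ?_
  by_cases h : τ t = m <;> simp [h]

/-- The path weights when the good arms are `θ`. -/
noncomputable def gameWeight {V : Type} {T M α : ℕ}
    (A : (t : Fin T) → (Fin t → V × Bool) → V → ℝ) (τ : Fin T → Fin M) (c : Fin T → V → Fin α)
    (ε : ℝ) (θ : Fin M → Option (Fin α)) (ω : Fin T → V × Bool) : ℝ :=
  pathWeight (actionBitKernel A fun t i => biasedBit (armBias ε τ θ t (c t i))) ω

theorem gameWeight_nonneg {V : Type} {T M α : ℕ}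
    {A : (t : Fin T) → (Fin t → V × Bool) → V → ℝ} {τ : Fin T → Fin M} {c : Fin T → V → Fin α}
    {ε : ℝ} (hA : ∀ t p i, 0 ≤ A t p i) (h0 : 0 ≤ ε) (h1 : ε ≤ 1 / 4)
    (θ : Fin M → Option (Fin α)) (ω : Fin T → V × Bool) : 0 ≤ gameWeight A τ c ε θ ω :=
  pathWeight_actionBitKernel_nonneg hA (fun t i b =>
    (biasedBit_pos (armBias_mem h0 h1 τ θ t (c t i)).1 (armBias_mem h0 h1 τ θ t (c t i)).2 b).le) ω

section
variable {V : Type} [Fintype V] {T M α : ℕ} {A : (t : Fin T) → (Fin t → V × Bool) → V → ℝ}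
  {τ : Fin T → Fin M} {c : Fin T → V → Fin α} {ε : ℝ}

theorem sum_gameWeight (hA : ∀ t p, ∑ i, A t p i = 1) (θ : Fin M → Option (Fin α)) :
    ∑ ω, gameWeight A τ c ε θ ω = 1 :=
  sum_pathWeight _ (sum_actionBitKernel hA fun _ _ => sum_biasedBit _)

/-- Revealing a good arm in a game without one raises the expected number of its pulls only in
proportion to the information that the pulls carry. -/
theorem sum_gameWeight_update_le (hA0 : ∀ t p i, 0 ≤ A t p i) (hA : ∀ t p, ∑ i, A t p i = 1)
    (h0 : 0 ≤ ε) (h1 : ε ≤ 1 / 4) (θ : Fin M → Option (Fin α)) (m : Fin M) (hm : θ m = none)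
    (e : Fin α) :
    ∑ ω, gameWeight A τ c ε (Function.update θ m (some e)) ω * pullCount τ c m e ω ≤
      ∑ ω, gameWeight A τ c ε θ ω * pullCount τ c m e ω +
        gameLength τ m * (-(1 / 2) * Real.log (1 - 4 * ε ^ 2) *
          ∑ ω, gameWeight A τ c ε θ ω * pullCount τ c m e ω + 1 / 8) := by
  -- The log-likelihood ratio of a fair bit against a biased one, present only when `e` is pulled in
  -- game `m`.
  set r : Fin T → V → Bool → ℝ := fun t j b =>
    if τ t = m ∧ c t j = e then -Real.log (2 * biasedBit ε b) else 0 with hr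
  set R : (Fin T → V × Bool) → ℝ := fun ω => ∑ t, r t (ω t).1 (ω t).2 with hR
  have hq : ∀ t j b, biasedBit (armBias ε τ (Function.update θ m (some e)) t (c t j)) b =
      biasedBit (armBias ε τ θ t (c t j)) b * Real.exp (-r t j b) := by
    intro t j b
    by_cases ht : τ t = m
    · by_cases hj : c t j = e
      · have hp := biasedBit_pos h0 h1 b
        simp only [hr, armBias, ht, hj, hm, Function.update_self, and_self, if_true, neg_neg,
          reduceCtorEq, if_false]
        rw [Real.exp_log (by positivity)]
        cases b <;> simp [biasedBit]
      · have hj' : e ≠ c t j := fun h => hj h.symm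
        simp [hr, armBias, ht, hj, hj', hm]
    · simp [hr, armBias, ht, Function.update_of_ne]
  have hW : ∀ ω, gameWeight A τ c ε (Function.update θ m (some e)) ω =
      gameWeight A τ c ε θ ω * Real.exp (-R ω) :=
    fun ω => pathWeight_actionBitKernel_exp A hq ω
  have hER : ∑ ω, gameWeight A τ c ε θ ω * R ω = -(1 / 2) * Real.log (1 - 4 * ε ^ 2) *
      ∑ ω, gameWeight A τ c ε θ ω * pullCount τ c m e ω := by
    simp only [hR, pullCount, Finset.mul_sum]
    rw [Finset.sum_comm]
    nth_rewrite 2 [Finset.sum_comm]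
    refine Finset.sum_congr rfl fun t _ => ?_
    unfold gameWeight
    rw [sum_pathWeight_actionBitKernel_mul hA (fun _ _ => sum_biasedBit _) t (r t)]
    refine Finset.sum_congr rfl fun ω _ => ?_
    rw [mul_left_comm]
    congr 1
    by_cases h : τ t = m ∧ c t (ω t).1 = e
    · have hl : Real.log (1 - 4 * ε ^ 2) =
          Real.log (2 * biasedBit ε true) + Real.log (2 * biasedBit ε false) := by
        rw [← Real.log_mul]
        · simp [biasedBit]; ring_nf
        · have := biasedBit_pos h0 h1 true; positivity
        · have := biasedBit_pos h0 h1 false; positivity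
      rw [hl]
      simp only [hr, h, and_self, if_true, armBias, hm, reduceCtorEq, if_false, Fintype.sum_bool]
      simp only [biasedBit, if_true]
      simp
      ring
    · simp [hr, h]
  rcases (gameLength_nonneg τ m).eq_or_lt with hn | hn
  -- An empty game is treated apart because the change of measure is applied to the fraction of
  -- pulls.
  · have hz : ∀ ω : Fin T → V × Bool, pullCount τ c m e ω = 0 := fun ω =>
      le_antisymm (hn ▸ pullCount_le τ c m e ω) (pullCount_nonneg τ c m e ω)
    simp [hz, ← hn]
  · have key := sum_mul_exp_neg_sub_le (gameWeight A τ c ε θ) R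
      (fun ω => pullCount τ c m e ω / gameLength τ m) (gameWeight_nonneg hA0 h0 h1 θ)
      (sum_gameWeight hA θ)
      (by simp_rw [← hW]; exact sum_gameWeight hA _)
      (fun ω => ⟨div_nonneg (pullCount_nonneg τ c m e ω) hn.le,
        div_le_one_of_le₀ (pullCount_le τ c m e ω) hn.le⟩)
    rw [hER] at key
    simp_rw [← hW, ← mul_div_assoc, ← Finset.sum_div] at key
    rw [← sub_div, div_le_iff₀ hn] at key
    linarith

/-- Pulling the good arm of the current game lowers the conditional mean loss from `1 / 2` to `1 / 2
- ε`. -/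
theorem sum_gameWeight_loss (hA : ∀ t p, ∑ i, A t p i = 1) (θ : Fin M → Fin α) :
    ∑ ω, gameWeight A τ c ε (fun m => some (θ m)) ω * ∑ t, (if (ω t).2 then (1 : ℝ) else 0) =
      T / 2 - ε * ∑ m, ∑ ω, gameWeight A τ c ε (fun m => some (θ m)) ω *
        pullCount τ c m (θ m) ω := by
  have hN : ∀ ω : Fin T → V × Bool, ∑ m, pullCount τ c m (θ m) ω =
      ∑ t, if θ (τ t) = c t (ω t).1 then (1 : ℝ) else 0 := by
    intro ω
    unfold pullCount
    rw [Finset.sum_comm]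
    refine Finset.sum_congr rfl fun t _ => ?_
    rw [Finset.sum_eq_single (τ t)]
    · simp [eq_comm]
    · intro m _ hm
      simp [hm.symm]
    · simp
  rw [Finset.sum_comm (s := (Finset.univ : Finset (Fin M)))]
  simp_rw [← Finset.mul_sum (Finset.univ : Finset (Fin M)), hN]
  have ht : ∀ t, ∑ ω, gameWeight A τ c ε (fun m => some (θ m)) ω *
      (if (ω t).2 then (1 : ℝ) else 0) = ∑ ω, gameWeight A τ c ε (fun m => some (θ m)) ω *
        (1 / 2 - ε * if θ (τ t) = c t (ω t).1 then (1 : ℝ) else 0) := by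
    intro t
    unfold gameWeight
    rw [sum_pathWeight_actionBitKernel_mul hA (fun _ _ => sum_biasedBit _) t
      fun _ b => if b then (1 : ℝ) else 0]
    refine Finset.sum_congr rfl fun ω _ => ?_
    congr 1
    simp [biasedBit, armBias]
  calc _ = ∑ t, ∑ ω, gameWeight A τ c ε (fun m => some (θ m)) ω *
          (if (ω t).2 then (1 : ℝ) else 0) := by
        rw [Finset.sum_comm]; simp_rw [Finset.mul_sum]
    _ = ∑ ω, gameWeight A τ c ε (fun m => some (θ m)) ω *
          (T / 2 - ε * ∑ t, if θ (τ t) = c t (ω t).1 then (1 : ℝ) else 0) := by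
        simp_rw [ht]
        rw [Finset.sum_comm]
        refine Finset.sum_congr rfl fun ω _ => ?_
        rw [← Finset.mul_sum, Finset.sum_sub_distrib, Finset.mul_sum]
        simp [div_eq_mul_inv]
    _ = _ := by
        simp_rw [mul_sub]
        rw [Finset.sum_sub_distrib, ← Finset.sum_mul, sum_gameWeight hA, one_mul, Finset.mul_sum]
        congr 1
        exact Finset.sum_congr rfl fun ω _ => by ring

/-- Averaged over the good arms, few pulls hit the good arm. -/
theorem sum_sum_gameWeight_pullCount_le (hA0 : ∀ t p i, 0 ≤ A t p i)
    (hA : ∀ t p, ∑ i, A t p i = 1) (h0 : 0 ≤ ε) (h1 : ε ≤ 1 / 4) :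
    (α : ℝ) * ∑ θ : Fin M → Fin α, ∑ m,
      ∑ ω, gameWeight A τ c ε (fun m => some (θ m)) ω * pullCount τ c m (θ m) ω ≤
    (α : ℝ) ^ M * ∑ m, (gameLength τ m + gameLength τ m *
      (-(1 / 2) * Real.log (1 - 4 * ε ^ 2) * gameLength τ m + α / 8)) := by
  rw [Finset.sum_comm, Finset.mul_sum, Finset.mul_sum]
  refine Finset.sum_le_sum fun m _ => ?_
  have hs := sum_sum_update m fun θ : Fin M → Fin α =>
    ∑ ω, gameWeight A τ c ε (fun m => some (θ m)) ω * pullCount τ c m (θ m) ω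
  rw [Fintype.card_fin] at hs
  rw [← hs]
  have hc : (α : ℝ) ^ M = ∑ _θ : Fin M → Fin α, (1 : ℝ) := by simp
  rw [hc, Finset.sum_mul]
  refine Finset.sum_le_sum fun θ _ => ?_
  rw [one_mul]
  -- One comparison law serves all values `e` of the resampled good arm; this is what lets the pull
  -- counts be summed over `e`.
  set θ₀ : Fin M → Option (Fin α) := Function.update (fun k => some (θ k)) m none with hθ₀
  have hu : ∀ e, (fun k => some (Function.update θ m e k)) = Function.update θ₀ m (some e) := by
    intro e
    funext k
    by_cases hk : k = m
    · subst hk; simp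
    · simp [hθ₀, hk]
  simp_rw [hu, Function.update_self]
  refine (Finset.sum_le_sum fun e _ => sum_gameWeight_update_le hA0 hA h0 h1 θ₀ m
    (by simp [hθ₀]) e).trans (le_of_eq ?_)
  have hE : ∑ e, ∑ ω, gameWeight A τ c ε θ₀ ω * pullCount τ c m e ω = gameLength τ m := by
    rw [Finset.sum_comm]
    simp_rw [← Finset.mul_sum, sum_pullCount, ← Finset.sum_mul, sum_gameWeight hA, one_mul]
  rw [Finset.sum_add_distrib, hE, ← Finset.mul_sum, Finset.sum_add_distrib, ← Finset.mul_sum, hE]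
  simp [div_eq_mul_inv]

end

/-! ### Lengths of the cyclically played games -/

/-- The squared lengths of games played in turn. -/
theorem sum_gameLength_mod {T M : ℕ} (hM : 0 < M) :
    ∑ m, gameLength (fun t : Fin T => (⟨t % M, Nat.mod_lt _ hM⟩ : Fin M)) m = T ∧
    ∑ m, gameLength (fun t : Fin T => (⟨t % M, Nat.mod_lt _ hM⟩ : Fin M)) m ^ 2 ≤
      (T : ℝ) ^ 2 / M + M / 4 := by
  set n := gameLength (fun t : Fin T => (⟨t % M, Nat.mod_lt _ hM⟩ : Fin M)) with hn
  have h1 : ∑ m, n m = T := by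
    simp only [hn, gameLength]
    rw [Finset.sum_comm]
    simp
  refine ⟨h1, ?_⟩
  have hq : ∀ m, n m = (T / M : ℕ) ∨ n m = (T / M : ℕ) + 1 := by
    intro m
    have : n m = (Nat.count (· ≡ m [MOD M]) T : ℕ) := by
      simp only [hn, gameLength]
      rw [Fin.sum_univ_eq_sum_range (fun t => if (⟨t % M, Nat.mod_lt _ hM⟩ : Fin M) = m
        then (1 : ℝ) else 0) T, Nat.count_eq_card_filter_range, Finset.sum_boole]
      congr 2
      refine Finset.filter_congr fun t _ => ?_
      rw [Fin.ext_iff, Nat.ModEq, Nat.mod_eq_of_lt m.2]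
    rw [this, Nat.count_modEq_card _ hM]
    split_ifs <;> simp
  -- On two consecutive integers the square agrees with an affine function, so the sum of squares is
  -- determined by `T`.
  have h2 : ∀ m, n m ^ 2 = (2 * (T / M : ℕ) + 1) * n m - (T / M : ℕ) * ((T / M : ℕ) + 1) := by
    intro m
    rcases hq m with h | h <;> rw [h] <;> ring
  simp_rw [h2]
  rw [Finset.sum_sub_distrib, ← Finset.mul_sum, h1]
  simp only [Finset.sum_const, Finset.card_univ, Fintype.card_fin, nsmul_eq_mul]
  have hM' : (0 : ℝ) < M := by exact_mod_cast hM
  have hsq := mul_nonneg hM'.le (sq_nonneg ((T : ℝ) / M - (T / M : ℕ) - 1 / 2))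
  have e : (M : ℝ) * ((T : ℝ) / M - (T / M : ℕ) - 1 / 2) ^ 2 = (T : ℝ) ^ 2 / M + M / 4 -
      ((2 * (T / M : ℕ) + 1) * T - M * ((T / M : ℕ) * ((T / M : ℕ) + 1))) := by
    field_simp
    ring
  linarith

/-! ### Clique graphs and the reduction to bandits -/

/-- The graph, with all self-loops, in which the classes of a labelling are cliques. -/
def FeedbackGraph.ofLabelling {K α : ℕ} (d : Fin K → Fin α) : FeedbackGraph K where
  Adj i j := d i = d j
  symm _ _ h := h.symm

theorem FeedbackGraph.stronglyObservable_ofLabelling {K α : ℕ} (d : Fin K → Fin α) :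
    (FeedbackGraph.ofLabelling d).StronglyObservable := fun _ => Or.inl rfl

/-- An independent set meets each class at most once, and a section of `d` picks one action from
every class. -/
theorem FeedbackGraph.indepNum_ofLabelling {K α : ℕ} (d : Fin K → Fin α)
    (hd : Function.Surjective d) : (FeedbackGraph.ofLabelling d).indepNum = α := by
  apply le_antisymm
  · obtain ⟨s, hs⟩ := (FeedbackGraph.ofLabelling d).toSimpleGraph.exists_isNIndepSet_indepNum
    rw [FeedbackGraph.indepNum, ← hs.card_eq]
    have hinj : Set.InjOn d s := by
      intro i hi j hj hij
      by_contra hne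
      exact hs.isIndepSet hi hj hne ⟨hne, hij⟩
    calc s.card = (s.image d).card := (Finset.card_image_of_injOn hinj).symm
      _ ≤ Fintype.card (Fin α) := Finset.card_le_univ _
      _ = α := Fintype.card_fin α
  · obtain ⟨g, hg⟩ := hd.hasRightInverse
    have hi : (FeedbackGraph.ofLabelling d).toSimpleGraph.IsIndepSet
        (Finset.univ.image g : Finset (Fin K)) := by
      intro i hi j hj hne h
      simp only [Finset.coe_image, Finset.coe_univ, Set.image_univ, Set.mem_range] at hi hj
      obtain ⟨x, rfl⟩ := hi
      obtain ⟨y, rfl⟩ := hj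
      have hxy : d (g x) = d (g y) := h.2
      rw [hg x, hg y] at hxy
      exact hne (congrArg g hxy)
    have hle := hi.card_le_indepNum
    rwa [Finset.card_image_of_injective _ hg.injective, Finset.card_univ, Fintype.card_fin] at hle

/-- The losses in which the arms of a labelling have the given bits. -/
noncomputable def bitLoss {K T α : ℕ} (c : Fin T → Fin K → Fin α) (y : Fin T → Fin α → Bool)
    (t : Fin T) (i : Fin K) : ℝ := if y t (c t i) then 1 else 0

/-- The record of a round in which the action `v.1` is played and the revealed loss is `v.2`. -/
noncomputable def bitRecord {K α : ℕ} (d : Fin K → Fin α) (v : Fin K × Bool) : RoundRecord K where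
  action := v.1
  graph := FeedbackGraph.ofLabelling d
  observed := {x | ∃ j, d v.1 = d j ∧ x = (j, if v.2 then 1 else 0)}

/-- The probabilities with which an algorithm chooses its actions from the revealed bits. -/
noncomputable def bitPolicy {K T α : ℕ} (alg : LearnerAlgorithm K) (c : Fin T → Fin K → Fin α)
    (t : Fin T) (p : Fin t → Fin K × Bool) (i : Fin K) : ℝ :=
  (alg t (fun s => bitRecord (c (s.castLE t.isLt.le)) (p s)) i).toReal

theorem PMF.sum_toReal {V : Type} [Fintype V] (p : PMF V) : ∑ v, (p v).toReal = 1 := by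
  have h : ∑ v, p v = 1 := (tsum_fintype _).symm.trans p.tsum_coe
  rw [← ENNReal.toReal_sum fun v _ => p.apply_ne_top v, h, ENNReal.toReal_one]

/-- All neighbours of the played action share its label and hence its loss, so the record is
determined by the action and one bit. -/
theorem actionLaw_bitLoss {K T α : ℕ} (alg : LearnerAlgorithm K) (c : Fin T → Fin K → Fin α)
    (y : Fin T → Fin α → Bool) (a : Fin T → Fin K) :
    (actionLaw alg (bitLoss c y) (fun t => FeedbackGraph.ofLabelling (c t)) a).toReal =
      ∏ t, bitPolicy alg c t
        (fun s => (a (s.castLE t.isLt.le), y (s.castLE t.isLt.le)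
          (c (s.castLE t.isLt.le) (a (s.castLE t.isLt.le))))) (a t) := by
  have h : actionLaw alg (bitLoss c y) (fun t => FeedbackGraph.ofLabelling (c t)) a =
      ∏ t : Fin T, alg t (pastRecord (bitLoss c y)
        (fun t => FeedbackGraph.ofLabelling (c t)) a t) (a t) := rfl
  rw [h, ENNReal.toReal_prod]
  refine Finset.prod_congr rfl fun t _ => ?_
  unfold bitPolicy pastRecord
  congr 4
  funext s
  simp only [playRound, bitRecord, RoundRecord.mk.injEq, true_and]
  ext x
  refine exists_congr fun j => and_congr_right fun h => ?_
  have h' : c (s.castLE t.isLt.le) (a (s.castLE t.isLt.le)) = c (s.castLE t.isLt.le) j := h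
  simp only [bitLoss, ← h']

/-- Averaging over the bits of all arms leaves only the revealed bits. -/
theorem sum_bits_actionLaw {K T M α : ℕ} (alg : LearnerAlgorithm K) (c : Fin T → Fin K → Fin α)
    (τ : Fin T → Fin M) (ε : ℝ) (θ : Fin M → Option (Fin α)) :
    ∑ y : Fin T → Fin α → Bool, (∏ t, ∏ e, biasedBit (armBias ε τ θ t e) (y t e)) *
      ∑ a, (actionLaw alg (bitLoss c y) (fun t => FeedbackGraph.ofLabelling (c t)) a).toReal *
        ∑ t, bitLoss c y t (a t) =
    ∑ ω, gameWeight (bitPolicy alg c) τ c ε θ ω * ∑ t, if (ω t).2 then (1 : ℝ) else 0 := by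
  simp_rw [Finset.mul_sum Finset.univ (fun a : Fin T → Fin K => _ * _)]
  rw [Finset.sum_comm, ← Equiv.sum_comp (Equiv.arrowProdEquivProdArrow _ _ _).symm,
    Fintype.sum_prod_type]
  -- For a fixed action sequence `a`, the integrand sees `y` only through the bits at `c t (a t)`,
  -- so the other bits integrate out.
  refine Finset.sum_congr rfl fun a _ => ?_
  have h := sum_prod_prod_mul_comp (fun t e => biasedBit (armBias ε τ θ t e))
    (fun _ _ => sum_biasedBit _) (fun t => c t (a t)) fun b =>
      (∏ t, bitPolicy alg c t
        (fun s => (a (s.castLE t.isLt.le), b (s.castLE t.isLt.le))) (a t)) *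
        ∑ t, if b t then (1 : ℝ) else 0
  simp_rw [actionLaw_bitLoss]
  refine h.trans (Finset.sum_congr rfl fun b _ => ?_)
  rw [← mul_assoc]
  congr 1
  rw [mul_comm, ← Finset.prod_mul_distrib]
  rfl

/-- The expected loss of an action that is good in all games. -/
theorem sum_bits_bitLoss {K T M α : ℕ} (c : Fin T → Fin K → Fin α) (τ : Fin T → Fin M) (ε : ℝ)
    (θ : Fin M → Fin α) (i : Fin K) (hi : ∀ t, c t i = θ (τ t)) :
    ∑ y : Fin T → Fin α → Bool,
      (∏ t, ∏ e, biasedBit (armBias ε τ (fun m => some (θ m)) t e) (y t e)) *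
        ∑ t, bitLoss c y t i = T * (1 / 2 - ε) := by
  have h := sum_prod_prod_mul_comp (fun t e => biasedBit (armBias ε τ (fun m => some (θ m)) t e))
    (fun _ _ => sum_biasedBit _) (fun t => c t i) fun b => ∑ t, if b t then (1 : ℝ) else 0
  refine h.trans ?_
  simp_rw [hi, armBias, if_true, Finset.mul_sum]
  rw [Finset.sum_comm (s := (Finset.univ : Finset (Fin T → Bool)))]
  have ht : ∀ t, ∑ b : Fin T → Bool, (∏ t, biasedBit ε (b t)) * (if b t then (1 : ℝ) else 0) =
      1 / 2 - ε := by
    intro t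
    have hw : ∀ (t : Fin T) (p : Fin t → Bool), ∑ v, (fun _ _ => biasedBit ε :
      (t : Fin T) → (Fin t → Bool) → Bool → ℝ) t p v = 1 := fun _ _ => sum_biasedBit ε
    refine (sum_pathWeight_mul_eq _ hw t fun b => if b then (1 : ℝ) else 0).trans ?_
    rw [← Finset.sum_mul, sum_pathWeight _ hw]
    simp [biasedBit]
  rw [Finset.sum_congr rfl fun t _ => ht t, Finset.sum_const, Finset.card_univ, Fintype.card_fin,
    nsmul_eq_mul]

theorem sum_bits {T α : ℕ} (x : Fin T → Fin α → ℝ) :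
    ∑ y : Fin T → Fin α → Bool, ∏ t, ∏ e, biasedBit (x t e) (y t e) = 1 := by
  rw [sum_prod_apply fun t (z : Fin α → Bool) => ∏ e, biasedBit (x t e) (z e)]
  refine Finset.prod_eq_one fun t _ => ?_
  rw [sum_prod_apply]
  exact Finset.prod_eq_one fun e _ => sum_biasedBit _

/-! ### The regret bound and its tuning -/

/-- Some losses with values in `{0, 1}` make the regret large in `M` simultaneous games. -/
theorem exists_bits_le_regret {K T M α : ℕ} (hα : 0 < α) (alg : LearnerAlgorithm K)
    (D : Fin K → Fin M → Fin α) (hD : Function.Surjective D) (τ : Fin T → Fin M) {ε : ℝ}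
    (h0 : 0 ≤ ε) (h1 : ε ≤ 1 / 4) :
    ∃ y : Fin T → Fin α → Bool,
      ε * (T - (∑ m, (gameLength τ m + gameLength τ m *
        (-(1 / 2) * Real.log (1 - 4 * ε ^ 2) * gameLength τ m + α / 8))) / α) ≤
      regret alg (bitLoss (fun t i => D i (τ t)) y)
        (fun t => FeedbackGraph.ofLabelling fun i => D i (τ t)) := by
  set c : Fin T → Fin K → Fin α := fun t i => D i (τ t) with hc
  set reg : (Fin T → Fin α → Bool) → ℝ := fun y => regret alg (bitLoss c y)
        (fun t => FeedbackGraph.ofLabelling (c t)) with hreg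
  -- The maximizer dominates the average over `y` for every `θ` at once, so no particular `θ` has to
  -- be selected.
  obtain ⟨y₀, hy₀⟩ := Finite.exists_max reg
  refine ⟨y₀, ?_⟩
  change _ ≤ reg y₀
  have hA0 : ∀ t p i, 0 ≤ bitPolicy alg c t p i := fun _ _ _ => ENNReal.toReal_nonneg
  have hA : ∀ t p, ∑ i, bitPolicy alg c t p i = 1 := fun _ _ => PMF.sum_toReal _
  have hθ : ∀ θ : Fin M → Fin α, ε * T - ε * ∑ m,
      ∑ ω, gameWeight (bitPolicy alg c) τ c ε (fun m => some (θ m)) ω *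
        pullCount τ c m (θ m) ω ≤ reg y₀ := by
    intro θ
    obtain ⟨i, hi⟩ := hD θ
    set P : (Fin T → Fin α → Bool) → ℝ := fun y =>
      ∏ t, ∏ e, biasedBit (armBias ε τ (fun m => some (θ m)) t e) (y t e) with hP
    have hP0 : ∀ y, 0 ≤ P y := fun y => Finset.prod_nonneg fun t _ => Finset.prod_nonneg fun e _ =>
      (biasedBit_pos (armBias_mem h0 h1 τ _ t e).1 (armBias_mem h0 h1 τ _ t e).2 _).le
    have hsum : ∑ y, P y = 1 := sum_bits _
    have hle : ∀ y, (∑ a, (actionLaw alg (bitLoss c y)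
        (fun t => FeedbackGraph.ofLabelling (c t)) a).toReal * ∑ t, bitLoss c y t (a t)) -
          ∑ t, bitLoss c y t i ≤ reg y₀ := by
      intro y
      refine le_trans ?_ (hy₀ y)
      simp only [hreg, regret]
      -- The best action in hindsight does at least as well as the action that is good in all games.
      exact sub_le_sub_left (ciInf_le (f := fun i => ∑ t, bitLoss c y t i)
        (Set.finite_range _).bddBelow i) _
    have hav : ∑ y, P y * ((∑ a, (actionLaw alg (bitLoss c y)
        (fun t => FeedbackGraph.ofLabelling (c t)) a).toReal * ∑ t, bitLoss c y t (a t)) -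
          ∑ t, bitLoss c y t i) ≤ reg y₀ := by
      calc _ ≤ ∑ y, P y * reg y₀ :=
            Finset.sum_le_sum fun y _ => mul_le_mul_of_nonneg_left (hle y) (hP0 y)
        _ = reg y₀ := by rw [← Finset.sum_mul, hsum, one_mul]
    simp_rw [mul_sub] at hav
    rw [Finset.sum_sub_distrib, sum_bits_actionLaw, sum_gameWeight_loss hA,
      sum_bits_bitLoss c τ ε θ i fun t => by simp [hc, hi]] at hav
    linarith
  have hsum := Finset.sum_le_sum fun θ (_ : θ ∈ (Finset.univ : Finset (Fin M → Fin α))) => hθ θ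
  rw [Finset.sum_sub_distrib, ← Finset.mul_sum, ← Finset.mul_sum] at hsum
  simp only [Finset.sum_const, Finset.card_univ, Fintype.card_fun, Fintype.card_fin, nsmul_eq_mul,
    Nat.cast_pow] at hsum
  have hpull := sum_sum_gameWeight_pullCount_le (M := M) (τ := τ) (c := c) hA0 hA h0 h1
  have hα' : (0 : ℝ) < α := by exact_mod_cast hα
  have hpow : (0 : ℝ) < (α : ℝ) ^ M := pow_pos hα' M
  rw [← le_div_iff₀' hα', mul_div_assoc] at hpull
  have h2 := mul_le_mul_of_nonneg_left hpull h0
  refine le_of_mul_le_mul_left ?_ hpow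
  linarith

/-- The tuning of the bias in `exists_bits_le_regret`. -/
theorem sqrt_le_of_tuned {α T M lg L : ℝ} (hα : 2 ≤ α) (hM : 0 < M) (hT : 0 < T)
    (hlg : lg ≤ 2 * M) (hL0 : 0 < L) (hL : L ≤ 1.152) (hn : α * M ≤ L * T) :
    1 / (18 * √2) * √(α * T * lg) ≤
      1 / 4 * √(α * M / (L * T)) * (T / 4 - M ^ 2 / (32 * T)) := by
  have h1 : √(α * T * lg) ≤ √2 * √(α * T * M) := by
    rw [← Real.sqrt_mul (by norm_num)]
    refine Real.sqrt_le_sqrt ?_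
    have : 0 ≤ α * T := by positivity
    nlinarith
  -- The constant `1.0734` is slightly more than `√1.152`.
  have hl : 1 / 1.0734 * √(α * T * M) ≤ √(α * M / (L * T)) * T := by
    refine (pow_le_pow_iff_left₀ (by positivity) (by positivity) two_ne_zero).1 ?_
    rw [mul_pow, mul_pow, Real.sq_sqrt (by positivity), Real.sq_sqrt (by positivity)]
    have e : α * M / (L * T) * T ^ 2 = α * T * M / L := by field_simp
    rw [e, div_eq_mul_inv _ L, mul_comm]
    refine mul_le_mul_of_nonneg_left ?_ (by positivity)
    rw [one_div, inv_pow]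
    exact inv_anti₀ hL0 (hL.trans (by norm_num))
  have hMT : M / T ≤ 0.576 := by
    rw [div_le_iff₀ hT]
    nlinarith
  have hMT0 : 0 ≤ M / T := by positivity
  have h3 : 0.2396 ≤ 1 / 4 - (M / T) ^ 2 / 32 := by nlinarith
  have e : 1 / 4 * √(α * M / (L * T)) * (T / 4 - M ^ 2 / (32 * T)) =
      1 / 4 * (√(α * M / (L * T)) * T) * (1 / 4 - (M / T) ^ 2 / 32) := by field_simp
  rw [e]
  have hs : 0 ≤ √(α * T * M) := Real.sqrt_nonneg _
  calc 1 / (18 * √2) * √(α * T * lg) ≤ 1 / (18 * √2) * (√2 * √(α * T * M)) :=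
        mul_le_mul_of_nonneg_left h1 (by positivity)
    _ = 1 / 18 * √(α * T * M) := by field_simp
    _ ≤ 1 / 4 * (1 / 1.0734 * √(α * T * M)) * 0.2396 := by nlinarith
    _ ≤ _ := mul_le_mul (mul_le_mul_of_nonneg_left hl (by norm_num)) h3 (by norm_num)
        (by positivity)

theorem mainTheorem3 (K α : ℕ) (hK : 2 ≤ K) (hα : 2 ≤ α) (hαK : α ≤ K)
    (alg : LearnerAlgorithm K) (T : ℕ)
    (hT : (α : ℝ) * Real.logb α K / (4 * Real.log (4 / 3)) ≤ (T : ℝ)) :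
    ∃ (l : Fin T → Fin K → ℝ) (G : Fin T → FeedbackGraph K),
      (∀ t i, l t i ∈ Set.Icc (0 : ℝ) 1) ∧
      (∀ t, (G t).StronglyObservable) ∧
      (∀ t, (G t).indepNum = α) ∧
      1 / (18 * √2) * √((α : ℝ) * T * Real.logb α K) ≤ regret alg l G := by
  set M := Nat.log α K with hMdef
  have hM : 0 < M := Nat.log_pos hα hαK
  have hα2 : (2 : ℝ) ≤ α := by exact_mod_cast hα
  have hα1 : (1 : ℝ) < α := by linarith
  have hM1 : (1 : ℝ) ≤ M := by exact_mod_cast hM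
  have hK0 : (0 : ℝ) < K := by exact_mod_cast (by omega : 0 < K)
  have hpow : α ^ M ≤ K := Nat.pow_log_le_self α (by omega)
  have hlow : (M : ℝ) ≤ Real.logb α K := by
    rw [Real.le_logb_iff_rpow_le hα1 hK0, Real.rpow_natCast]
    exact_mod_cast hpow
  -- Rounding the logarithm down costs at most a factor `2`, which gives the `√2` in the final
  -- constant.
  have hup : Real.logb α K ≤ 2 * M := by
    have h : Real.logb α K ≤ (M + 1 : ℕ) := by
      rw [Real.logb_le_iff_le_rpow hα1 hK0, Real.rpow_natCast]
      exact_mod_cast (Nat.lt_pow_succ_log_self hα K).le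
    push_cast at h
    linarith
  have hL0 : 0 < 4 * Real.log (4 / 3) := by
    have := Real.log_pos (show (1 : ℝ) < 4 / 3 by norm_num)
    linarith
  have hL : 4 * Real.log (4 / 3) ≤ 1.152 := by linarith [log_four_thirds_le]
  have hn : (α : ℝ) * M ≤ 4 * Real.log (4 / 3) * T := by
    rw [div_le_iff₀ hL0] at hT
    have := mul_le_mul_of_nonneg_left hlow (by linarith : (0 : ℝ) ≤ α)
    linarith
  have hT0 : (0 : ℝ) < T := by
    have : (0 : ℝ) < α * M := by positivity
    exact pos_of_mul_pos_right (this.trans_le hn) hL0.le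
  -- Since `α ^ M ≤ K`, the words embed into the actions; a left inverse of the embedding labels
  -- every action.
  obtain ⟨D, hD⟩ : ∃ D : Fin K → Fin M → Fin α, Function.Surjective D := by
    obtain ⟨f⟩ : Nonempty ((Fin M → Fin α) ↪ Fin K) :=
      Function.Embedding.nonempty_of_card_le (by simpa using hpow)
    have : Nonempty (Fin M → Fin α) := ⟨fun _ => ⟨0, by omega⟩⟩
    exact ⟨Function.invFun f, Function.invFun_surjective f.injective⟩
  set τ : Fin T → Fin M := fun t => ⟨t % M, Nat.mod_lt _ hM⟩ with hτ
  set L := 4 * Real.log (4 / 3) with hLdef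
  -- With this `ε` the entropy term and the slack `1 / 8` each contribute `T / 8` to the pulls of
  -- good arms, up to the remainder `M ^ 2 / (32 * T)`. The hypothesis on `T` gives `ε ≤ 1 / 4`.
  set ε := 1 / 4 * √(α * M / (L * T)) with hε
  have h0 : 0 ≤ ε := by positivity
  have h1 : ε ≤ 1 / 4 := by
    have : √(α * M / (L * T)) ≤ 1 := by
      rw [Real.sqrt_le_one]
      exact div_le_one_of_le₀ hn (by positivity)
    linarith
  have hε2 : ε ^ 2 = α * M / (16 * (L * T)) := by
    rw [hε, mul_pow, Real.sq_sqrt (by positivity)]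
    field_simp
    norm_num
  obtain ⟨y, hy⟩ := exists_bits_le_regret (by omega) alg D hD τ h0 h1
  refine ⟨_, _, ?_, fun t => FeedbackGraph.stronglyObservable_ofLabelling _, fun t =>
    FeedbackGraph.indepNum_ofLabelling _ ?_, le_trans ?_ hy⟩
  · intro t i
    unfold bitLoss
    split_ifs <;> simp
  · intro e
    obtain ⟨i, hi⟩ := hD fun _ => e
    exact ⟨i, congrFun hi _⟩
  · refine (sqrt_le_of_tuned hα2 (by linarith) hT0 hup hL0 hL hn).trans
      (mul_le_mul_of_nonneg_left ?_ h0)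
    obtain ⟨hs1, hs2⟩ := sum_gameLength_mod (T := T) hM
    set κ := -(1 / 2) * Real.log (1 - 4 * ε ^ 2) with hκ
    have hκle : κ ≤ α * M / (8 * T) := by
      refine (neg_log_one_sub_le ε h0 h1).trans (le_of_eq ?_)
      have : 8 * Real.log (4 / 3) = 2 * L := by rw [hLdef]; ring
      rw [this, hε2]
      field_simp
      norm_num
    have hsum : ∑ m, (gameLength τ m + gameLength τ m * (κ * gameLength τ m + α / 8)) =
        T + α * T / 8 + κ * ∑ m, gameLength τ m ^ 2 := by
      have : ∀ m, gameLength τ m + gameLength τ m * (κ * gameLength τ m + α / 8) =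
          (1 + (α : ℝ) / 8) * gameLength τ m + κ * gameLength τ m ^ 2 := fun m => by ring
      simp_rw [this]
      rw [Finset.sum_add_distrib, ← Finset.mul_sum, ← Finset.mul_sum, hs1]
      ring
    rw [hsum]
    have hα0 : (0 : ℝ) < α := by linarith
    have hM0 : (0 : ℝ) < M := by linarith
    have hk : κ * ∑ m, gameLength τ m ^ 2 ≤ α * M / (8 * T) * ((T : ℝ) ^ 2 / M + M / 4) :=
      mul_le_mul hκle hs2 (Finset.sum_nonneg fun m _ => sq_nonneg _) (by positivity)
    have hdiv : (T + α * T / 8 + κ * ∑ m, gameLength τ m ^ 2) / (α : ℝ) ≤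
        (T + α * T / 8 + α * M / (8 * T) * ((T : ℝ) ^ 2 / M + M / 4)) / α := by gcongr
    have e : (T + α * T / 8 + α * M / (8 * T) * ((T : ℝ) ^ 2 / M + M / 4)) / (α : ℝ) =
        T / α + T / 4 + M ^ 2 / (32 * T) := by
      field_simp
      ring
    have hTα : (T : ℝ) / α ≤ T / 2 := by gcongr
    linarith
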